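/- Let $\mathcal{C}at$ be the category of small categories and $e$ its final object (the point category). For functors $u:A\to B$ and $b\in B$, write $A/b$ (resp. $b\backslash A$) for the category of pairs $(a,\,u(a)\to b)$ (resp. $(a,\,b\to u(a))$), and $A_b$ for the fiber (objects $a$ with $u(a)=b$, arrows $f$ with $u(f)=\mathrm{id}_b$). Let $\mathcal W$ be a fundamental localizer, i.e. a class of arrows of $\mathcal{C}at$ such that: (LA) $\mathcal W$ contains the identities and satisfies two-out-of-three, and if $ri=\mathrm{id}$ and $ir\in\mathcal W$ then $r\in\mathcal W$; (LB) if a small category $A$ has a final object, then $(A\to e)\in\mathcal W$; (LC) if $u:A\to B$, $w:B\to C$ and $v=wu:A\to C$ are functors between small categories such that the induced functor $A/c\to B/c$ is in $\mathcal W$ for every object $c$ of $C$, then $u\in\mathcal W$. Given $u:A\to B$ and $w:B\to C$, the functor $u$ is a $\mathcal W$-equivalence colocally on $C$ if $c\backslash A\to c\backslash B$ is in $\mathcal W$ for every object $c$ of $C$; it is $\mathcal W$-coaspherical if this holds for $C=B$, $w=\mathrm{id}_B$. A functor $u:A\to B$ is $\mathcal W$-proper if for every object $b$ of $B$ the canonical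 functor $A_b\to A/b$, $a\mapsto(a,\mathrm{id}_b)$, is $\mathcal W$-coaspherical. A square of small categories, given by functors $v:A'\to A$, $u':A'\to B'$, $u:A\to B$, $w:B'\to B$ and a natural transformation $\alpha:uv\to wu'$, is weakly $\mathcal W$-exact if for every object $b'$ of $B'$ the functor $A'/b'\to A/w(b')$, $(a',g')\mapsto(v(a'),\,w(g')\alpha_{a'})$, is a $\mathcal W$-equivalence colocally on $A$. A square is cartesian if $uv=wu'$, $\alpha$ is the identity, and the induced functor $A'\to B'\times_B A$ is an isomorphism of categories. **Proposition.** Let $u:A\to B$ be an arrow of $\mathcal{C}at$. The following conditions are equivalent: (a) $u$ is $\mathcal W$-proper; (b) for every diagram of two cartesian squares $$\begin{array}{ccccc}A''&\xrightarrow{\ v'\ }&A'&\xrightarrow{\ v\ }&A\\ {\scriptstyle u''}\downarrow&&{\scriptstyle u'}\downarrow&&\downarrow{\scriptstyle u}\\ B''&\xrightarrow{\ w'\ }&B'&\xrightarrow{\ w\ }&B\end{array}$$ in $\mathcal{C}at$, the left-hand square is weakly $\mathcal W$-exact. -/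

import Mathlib

open CategoryTheory

universe u

/-- A class `W` of functors between small categories is *weakly saturated* if it contains the
identities, has the two-out-of-three property, and contains every retraction `r` of a functor `i`
such that the idempotent `i r` (first `r`, then `i`) is in `W`. -/
structure IsWeaklySaturated (W : MorphismProperty Cat.{u, u}) : Prop where
  id_mem : W.ContainsIdentities
  two_out_of_three : W.HasTwoOutOfThreeProperty
  retraction_mem : ∀ {A' A : Cat.{u, u}} (i : A' ⟶ A) (r : A ⟶ A'),
    i ≫ r = 𝟙 A' → W (r ≫ i) → W r

/-- A functor between (unbundled) small categories is a `W`-equivalence if it belongs to `W`. -/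
def IsWEquivalence (W : MorphismProperty Cat.{u, u}) {A B : Type u} [SmallCategory A]
    [SmallCategory B] (F : A ⥤ B) : Prop :=
  W F.toCatHom

/-- A *fundamental localizer*. In `relative` the commutative triangle is given by `F : A ⥤ B`,
`G : B ⥤ C` and `F ⋙ G : A ⥤ C`, and `CostructuredArrow.pre F G c` is the induced functor
`A/c ⥤ B/c` on slices. -/
structure IsFundamentalLocalizer (W : MorphismProperty Cat.{u, u}) : Prop where
  weaklySaturated : IsWeaklySaturated W
  of_hasTerminal : ∀ (A : Type u) [SmallCategory A], Limits.HasTerminal A →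
    IsWEquivalence W (Functor.star.{u} A : A ⥤ Discrete PUnit.{u + 1})
  relative : ∀ {A B C : Type u} [SmallCategory A] [SmallCategory B] [SmallCategory C]
    (F : A ⥤ B) (G : B ⥤ C),
    (∀ c : C, IsWEquivalence W (CostructuredArrow.pre F G c)) → IsWEquivalence W F

/-- For functors `F : A ⥤ B` and `G : B ⥤ C`, the functor `F` is a `W`-equivalence *colocally on*
`C` if for every object `c` of `C` the induced functor `c\A ⥤ c\B` on coslices is in `W`. -/
def IsColocalWEquivalence (W : MorphismProperty Cat.{u, u}) {A B C : Type u} [SmallCategory A]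
    [SmallCategory B] [SmallCategory C] (F : A ⥤ B) (G : B ⥤ C) : Prop :=
  ∀ c : C, IsWEquivalence W (StructuredArrow.pre c F G)

/-- `F : A ⥤ B` is *`W`-coaspherical* if for every object `b` of `B` the induced functor
`b\A ⥤ b\B` is in `W`. -/
def IsWCoaspherical (W : MorphismProperty Cat.{u, u}) {A B : Type u} [SmallCategory A]
    [SmallCategory B] (F : A ⥤ B) : Prop :=
  ∀ b : B, IsWEquivalence W (StructuredArrow.toUnder b F)

/-- The canonical functor `A_b ⥤ A/b`, `a ↦ (a, id_b : F a ⟶ b)`, from the (strict) fiber of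
`F : A ⥤ B` over `b` to the slice. -/
def fiberToSlice {A B : Type u} [SmallCategory A] [SmallCategory B] (F : A ⥤ B) (b : B) :
    F.Fiber b ⥤ CostructuredArrow F b :=
  Functor.toCostructuredArrow Functor.Fiber.fiberInclusion F b (fun a => eqToHom a.2)
    (fun {a a'} φ => by
      have := IsHomLift.fac' F (𝟙 b) (Functor.Fiber.fiberInclusion.map φ)
      simp only [Category.id_comp] at this
      rw [this]
      simp only [eqToHom_trans]
      exact eqToHom_trans _ _)

/-- A functor is *`W`-proper* if for every object `b` of the target the canonical functor
`A_b ⥤ A/b` is `W`-coaspherical. -/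
def IsWProper (W : MorphismProperty Cat.{u, u}) {A B : Type u} [SmallCategory A]
    [SmallCategory B] (F : A ⥤ B) : Prop :=
  ∀ b : B, IsWCoaspherical W (fiberToSlice F b)

/-- A square `α : v ⋙ u ⟶ u' ⋙ w` of small categories is *weakly `W`-exact* if for every object
`b'` of `B'` the functor `A'/b' ⥤ A/w(b')`, `(a', g') ↦ (v a', w(g') ∘ α_{a'})`, is a
`W`-equivalence colocally on `A`. -/
def IsWeaklyWExact (W : MorphismProperty Cat.{u, u}) {A' A B' B : Type u} [SmallCategory A']
    [SmallCategory A] [SmallCategory B'] [SmallCategory B] {v : A' ⥤ A} {u' : A' ⥤ B'}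
    {u : A ⥤ B} {w : B' ⥤ B} (α : TwoSquare v u' u w) : Prop :=
  ∀ b' : B', IsColocalWEquivalence W (α.costructuredArrowRightwards b')
    (CostructuredArrow.proj u (w.obj b'))

/-- A strictly commutative square of `Cat`, seen as a square whose 2-cell is the identity. -/
def identitySquare {A' A B' B : Cat.{u, u}} {v : A' ⟶ A} {u' : A' ⟶ B'} {u : A ⟶ B} {w : B' ⟶ B}
    (h : v ≫ u = u' ≫ w) : TwoSquare v.toFunctor u'.toFunctor u.toFunctor w.toFunctor :=
  TwoSquare.mk _ _ _ _ (eqToHom (congrArg Cat.Hom.toFunctor h))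

/-! A functor is coaspherical iff its coslices are aspherical, so properness of `u : A ⥤ B` says
that for every `p` in `A/b` the category of arrows from `p` to the fiber `A_b` is aspherical. In a
cartesian square such an arrow has its base component forced, so this category is unchanged, up to
equivalence, under base change (`isWAspherical_coslice_iff`); hence proper functors are stable under
base change.

(a) ⇒ (b): only the left square matters, with `u'` proper. In `A''_b ⥤ A''/b ⥤ A'/w'(b)` the first
functor and the composite have aspherical coslices, hence are colocal equivalences on any base, and
two-out-of-three gives the second.

(b) ⇒ (a): take `B' = B/b` and let `B''` be the point, sent to the terminal object. Then `A'` is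
essentially `A/b`, `A''` is essentially `A_b`, and exactness makes `A_b ⥤ A/b` coaspherical.

The axioms mention only slices; that aspherical coslices also suffice (`isWEquivalence_of_coslices`)
is proved with a twisted comma category. -/

open Limits

/-- A small category is `W`-aspherical if its functor to the point is in `W`. -/
def IsWAspherical (W : MorphismProperty Cat.{u, u}) (A : Type u) [SmallCategory A] : Prop :=
  IsWEquivalence W (Functor.star.{u} A : A ⥤ Discrete PUnit.{u + 1})

/-! ### The span `Bᵒᵖ ← TwistedComma F → A` and its slices. -/

/-- For `F : A ⥤ B`, the category of triples `(b, a, b ⟶ F a)`, covariant in `a` and contravariant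
in `b`: the category of elements of `Hom(-, F -)`. -/
structure TwistedComma {A B : Type u} [SmallCategory A] [SmallCategory B] (F : A ⥤ B) :
    Type u where
  src : B
  obj : A
  hom : src ⟶ F.obj obj

namespace TwistedComma

variable {A B : Type u} [SmallCategory A] [SmallCategory B] {F : A ⥤ B}

/-- Morphisms of `TwistedComma F`. -/
@[ext]
structure Hom (X Y : TwistedComma F) : Type u where
  left : Y.src ⟶ X.src
  right : X.obj ⟶ Y.obj
  w : left ≫ X.hom ≫ F.map right = Y.hom

instance : SmallCategory (TwistedComma F) where
  Hom := Hom
  id X := ⟨𝟙 _, 𝟙 _, by simp⟩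
  comp f g := ⟨g.left ≫ f.left, f.right ≫ g.right, by rw [← g.w, ← f.w]; simp⟩
  id_comp f := by apply Hom.ext <;> simp
  comp_id f := by apply Hom.ext <;> simp
  assoc f g h := by apply Hom.ext <;> simp

@[ext]
lemma hom_ext {X Y : TwistedComma F} {f g : X ⟶ Y} (h₁ : f.left = g.left)
    (h₂ : f.right = g.right) : f = g :=
  Hom.ext h₁ h₂

@[simp] lemma id_left (X : TwistedComma F) : Hom.left (𝟙 X) = 𝟙 _ := rfl
@[simp] lemma id_right (X : TwistedComma F) : Hom.right (𝟙 X) = 𝟙 _ := rfl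
@[simp] lemma comp_left {X Y Z : TwistedComma F} (f : X ⟶ Y) (g : Y ⟶ Z) :
    (f ≫ g).left = g.left ≫ f.left := rfl
@[simp] lemma comp_right {X Y Z : TwistedComma F} (f : X ⟶ Y) (g : Y ⟶ Z) :
    (f ≫ g).right = f.right ≫ g.right := rfl

variable (F) in
/-- The projection `(b, a, g) ↦ b`. -/
abbrev fst : TwistedComma F ⥤ Bᵒᵖ where
  obj X := Opposite.op X.src
  map f := f.left.op

variable (F) in
/-- The projection `(b, a, g) ↦ a`. -/
abbrev snd : TwistedComma F ⥤ A where
  obj X := X.obj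
  map f := f.right

variable (F) in
/-- The comparison functor `(b, a, g) ↦ (b, F a, g)`. -/
def toId : TwistedComma F ⥤ TwistedComma (𝟭 B) where
  obj X := ⟨X.src, F.obj X.obj, X.hom⟩
  map f := ⟨f.left, F.map f.right, f.w⟩

/-- The functor `((b', a, g), β : b ⟶ b') ↦ (a, g ∘ β)`. -/
def sliceFst (b : B) : CostructuredArrow (fst F) (Opposite.op b) ⥤ StructuredArrow b F where
  obj X := StructuredArrow.mk (X.hom.unop ≫ X.left.hom)
  map {X Y} f := StructuredArrow.homMk f.left.right (by
    have h : Y.hom.unop ≫ f.left.left = X.hom.unop := congrArg Quiver.Hom.unop (CostructuredArrow.w f)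
    have h' := f.left.w
    change (X.hom.unop ≫ X.left.hom) ≫ F.map f.left.right = Y.hom.unop ≫ Y.left.hom
    rw [← h, ← h']
    simp)

/-- The functor `((b, a', g), α : a' ⟶ a) ↦ (b, F α ∘ g)`. -/
def sliceSnd (a : A) : CostructuredArrow (snd F) a ⥤ (Over (F.obj a))ᵒᵖ where
  obj X := Opposite.op (Over.mk (X.left.hom ≫ F.map X.hom))
  map {X Y} f := (Over.homMk f.left.left (by
    have h : f.left.right ≫ Y.hom = X.hom := CostructuredArrow.w f
    have h' := f.left.w
    change f.left.left ≫ X.left.hom ≫ F.map X.hom = Y.left.hom ≫ F.map Y.hom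
    rw [← h, ← h', F.map_comp]
    simp) : Over.mk (Y.left.hom ≫ F.map Y.hom) ⟶ Over.mk (X.left.hom ≫ F.map X.hom)).op

/-- The object of the slice of `fst F` over `b` given by an object of the coslice of `F`. -/
abbrev ofStructuredArrow {b : B} (y : StructuredArrow b F) :
    CostructuredArrow (fst F) (Opposite.op b) :=
  CostructuredArrow.mk (S := fst F) (Y := ⟨b, y.right, y.hom⟩) (𝟙 _)

/-- The object of the slice of `snd F` over `a` given by an object over `F a`. -/
abbrev ofOver {a : A} (y : Over (F.obj a)) : CostructuredArrow (snd F) a :=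
  CostructuredArrow.mk (S := snd F) (Y := ⟨y.left, a, y.hom⟩) (𝟙 _)

lemma left_of_hom_ofStructuredArrow {b : B} {X : CostructuredArrow (fst F) (Opposite.op b)}
    {y : StructuredArrow b F} (f : X ⟶ ofStructuredArrow y) : f.left.left = X.hom.unop :=
  (Category.id_comp _).symm.trans (congrArg Quiver.Hom.unop (CostructuredArrow.w f))

lemma right_of_hom_ofOver {a : A} {X : CostructuredArrow (snd F) a}
    {y : Over (F.obj a)} (f : X ⟶ ofOver y) : f.left.right = X.hom :=
  (Category.comp_id _).symm.trans (CostructuredArrow.w f)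

/-- Morphisms out of `sliceFst b`. -/
def sliceFstHomEquiv {b : B} (X : CostructuredArrow (fst F) (Opposite.op b))
    (y : StructuredArrow b F) : ((sliceFst b).obj X ⟶ y) ≃ (X ⟶ ofStructuredArrow y) where
  toFun f := CostructuredArrow.homMk
    (Hom.mk (Y := ⟨b, y.right, y.hom⟩) X.hom.unop f.right
      ((Category.assoc _ _ _).symm.trans (StructuredArrow.w f)))
    (Category.comp_id X.hom)
  invFun f := StructuredArrow.homMk f.left.right (by
    have h := f.left.w
    rw [left_of_hom_ofStructuredArrow] at h
    exact (Category.assoc _ _ _).trans h)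
  left_inv f := rfl
  right_inv f := by
    ext
    · exact (left_of_hom_ofStructuredArrow f).symm
    · rfl

/-- Morphisms out of `sliceSnd a`. -/
def sliceSndHomEquiv {a : A} (X : CostructuredArrow (snd F) a)
    (y : (Over (F.obj a))ᵒᵖ) : ((sliceSnd a).obj X ⟶ y) ≃ (X ⟶ ofOver y.unop) where
  toFun f := CostructuredArrow.homMk
    (Hom.mk (Y := ⟨y.unop.left, a, y.unop.hom⟩) f.unop.left X.hom (Over.w f.unop))
    (Category.comp_id X.hom)
  invFun f := Quiver.Hom.op (Over.homMk (U := y.unop)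
    (V := Over.mk (X.left.hom ≫ F.map X.hom)) f.left.left (by
      have h := f.left.w
      rw [right_of_hom_ofOver] at h
      exact h))
  left_inv f := rfl
  right_inv f := by
    ext
    · rfl
    · exact (right_of_hom_ofOver f).symm

/-- Absorbing the structure arrow into the object reflects a slice onto the objects whose structure
arrow is an identity. Asphericity of slices of `fst F` and `snd F` can thus be read off from `b\A`
and `(B/F a)ᵒᵖ`. -/
instance (b : B) : (sliceFst b : _ ⥤ StructuredArrow b F).IsLeftAdjoint :=
  (Adjunction.adjunctionOfEquivRight sliceFstHomEquiv (fun {X' X y} f g => by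
    ext
    · exact (left_of_hom_ofStructuredArrow (f ≫ sliceFstHomEquiv X y g)).symm
    · rfl)).isLeftAdjoint

instance (a : A) : (sliceSnd a : CostructuredArrow (snd F) a ⥤ _).IsLeftAdjoint :=
  (Adjunction.adjunctionOfEquivRight sliceSndHomEquiv (fun {X' X y} f g => by
    ext
    · rfl
    · exact (right_of_hom_ofOver (f ≫ sliceSndHomEquiv X y g)).symm)).isLeftAdjoint

end TwistedComma

/-! ### Asphericity, adjoints, and passage from slices to coslices. -/

namespace IsFundamentalLocalizer

variable {W : MorphismProperty Cat.{u, u}} (hW : IsFundamentalLocalizer W)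
variable {A B C : Type u} [SmallCategory A] [SmallCategory B] [SmallCategory C]

include hW

lemma comp {F : A ⥤ B} {G : B ⥤ C} (hF : IsWEquivalence W F) (hG : IsWEquivalence W G) :
    IsWEquivalence W (F ⋙ G) :=
  have := hW.weaklySaturated.two_out_of_three
  W.comp_mem F.toCatHom G.toCatHom hF hG

lemma of_comp_right {F : A ⥤ B} {G : B ⥤ C} (hG : IsWEquivalence W G)
    (hFG : IsWEquivalence W (F ⋙ G)) : IsWEquivalence W F :=
  have := hW.weaklySaturated.two_out_of_three
  W.of_postcomp F.toCatHom G.toCatHom hG hFG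

lemma of_comp_left {F : A ⥤ B} {G : B ⥤ C} (hF : IsWEquivalence W F)
    (hFG : IsWEquivalence W (F ⋙ G)) : IsWEquivalence W G :=
  have := hW.weaklySaturated.two_out_of_three
  W.of_precomp F.toCatHom G.toCatHom hF hFG

lemma isWAspherical_iff {F : A ⥤ B} (hF : IsWEquivalence W F) :
    IsWAspherical W A ↔ IsWAspherical W B := by
  have h : F ⋙ Functor.star.{u} B = Functor.star A := Functor.punit_ext' _ _
  exact ⟨fun hA => hW.of_comp_left hF (h ▸ hA),
    fun hB => by rw [IsWAspherical, ← h]; exact hW.comp hF hB⟩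

lemma isWEquivalence_of_isWAspherical (F : A ⥤ B) (hA : IsWAspherical W A)
    (hB : IsWAspherical W B) : IsWEquivalence W F := by
  have h : F ⋙ Functor.star.{u} B = Functor.star A := Functor.punit_ext' _ _
  exact hW.of_comp_right hB (h ▸ hA)

lemma isWAspherical_of_hasTerminal [HasTerminal A] : IsWAspherical W A :=
  hW.of_hasTerminal A inferInstance

/-- A functor with aspherical slices is in `W`. -/
lemma isWEquivalence_of_slices (F : A ⥤ B)
    (h : ∀ b, IsWAspherical W (CostructuredArrow F b)) : IsWEquivalence W F :=
  hW.relative F (𝟭 B) fun b => by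
    have : HasTerminal (CostructuredArrow (𝟭 B) b) :=
      (CostructuredArrow.mkIdTerminal (S := 𝟭 B) (Y := b)).hasTerminal
    exact hW.isWEquivalence_of_isWAspherical _ (h b) hW.isWAspherical_of_hasTerminal

lemma isWEquivalence_of_isLeftAdjoint (F : A ⥤ B) [F.IsLeftAdjoint] : IsWEquivalence W F :=
  hW.isWEquivalence_of_slices F fun b => by
    have := isLeftAdjoint_iff_hasTerminal_costructuredArrow.1 ‹F.IsLeftAdjoint› b
    exact hW.isWAspherical_of_hasTerminal

lemma isWAspherical_iff_of_isLeftAdjoint (F : A ⥤ B) [F.IsLeftAdjoint] :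
    IsWAspherical W A ↔ IsWAspherical W B :=
  hW.isWAspherical_iff (hW.isWEquivalence_of_isLeftAdjoint F)

/-- The functor from the point selecting an initial object is a left adjoint. -/
lemma isWAspherical_of_isInitial {x : A} (hx : IsInitial x) : IsWAspherical W A := by
  let F : Discrete PUnit.{u + 1} ⥤ A := Functor.fromPUnit x
  have : F.IsLeftAdjoint :=
    (Adjunction.adjunctionOfEquivRight (F := F) (G_obj := fun _ => ⟨⟨⟩⟩) (fun _ y =>
      { toFun _ := 𝟙 _
        invFun _ := hx.to y
        left_inv _ := hx.hom_ext _ _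
        right_inv _ := Subsingleton.elim _ _ })
      (fun _ _ _ _ _ => Subsingleton.elim _ _)).isLeftAdjoint
  have : HasTerminal (Discrete PUnit.{u + 1}) :=
    (IsTerminal.ofUniqueHom (Y := (⟨⟨⟩⟩ : Discrete PUnit.{u + 1})) (fun _ => 𝟙 _)
      (fun _ _ => Subsingleton.elim _ _)).hasTerminal
  exact (hW.isWAspherical_iff_of_isLeftAdjoint F).1 hW.isWAspherical_of_hasTerminal

/-- A functor is coaspherical if and only if its coslices are aspherical. -/
lemma isWCoaspherical_iff (F : A ⥤ B) :
    IsWCoaspherical W F ↔ ∀ b, IsWAspherical W (StructuredArrow b F) := by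
  have h (b : B) : IsWAspherical W (Under b) := hW.isWAspherical_of_isInitial Under.mkIdInitial
  exact ⟨fun hF b => (hW.isWAspherical_iff (hF b)).2 (h b),
    fun hF b => hW.isWEquivalence_of_isWAspherical _ (hF b) (h b)⟩

lemma isWEquivalence_twistedComma_fst (F : A ⥤ B)
    (h : ∀ b, IsWAspherical W (StructuredArrow b F)) :
    IsWEquivalence W (TwistedComma.fst F) :=
  hW.isWEquivalence_of_slices _ fun b =>
    (hW.isWAspherical_iff_of_isLeftAdjoint (TwistedComma.sliceFst b.unop)).2 (h _)

lemma isWEquivalence_twistedComma_snd (F : A ⥤ B) : IsWEquivalence W (TwistedComma.snd F) :=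
  hW.isWEquivalence_of_slices _ fun a =>
    (hW.isWAspherical_iff_of_isLeftAdjoint (TwistedComma.sliceSnd a)).2
      (hW.isWAspherical_of_isInitial (initialOpOfTerminal Over.mkIdTerminal))

/-- A functor with aspherical coslices is in `W`. -/
lemma isWEquivalence_of_coslices (F : A ⥤ B)
    (h : ∀ b, IsWAspherical W (StructuredArrow b F)) : IsWEquivalence W F := by
  -- `F` is compared with `𝟭 B`: the triangle over `Bᵒᵖ` puts `toId F` in `W`, and the square formed
  -- with the `snd` projections then gives `F`.
  have hid : IsWEquivalence W (TwistedComma.fst (𝟭 B)) :=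
    hW.isWEquivalence_twistedComma_fst _ fun b =>
      hW.isWAspherical_of_isInitial (StructuredArrow.mkIdInitial (T := 𝟭 B) (Y := b))
  have hto : IsWEquivalence W (TwistedComma.toId F) :=
    hW.of_comp_right hid (hW.isWEquivalence_twistedComma_fst F h)
  have hsnd : IsWEquivalence W (TwistedComma.snd F ⋙ F) :=
    hW.comp (F := TwistedComma.toId F) hto (hW.isWEquivalence_twistedComma_snd (𝟭 B))
  exact hW.of_comp_left (hW.isWEquivalence_twistedComma_snd F) hsnd

/-- A functor with aspherical coslices is an equivalence colocally on any base. -/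
lemma isColocalWEquivalence_of_coslices (F : A ⥤ B)
    (h : ∀ b, IsWAspherical W (StructuredArrow b F)) (G : B ⥤ C) :
    IsColocalWEquivalence W F G := fun _ =>
  -- The coslice of `c\A ⥤ c\B` under `c ⟶ G b` is just `b\A`.
  hW.isWEquivalence_of_coslices _ fun f =>
    (hW.isWAspherical_iff_of_isLeftAdjoint (StructuredArrow.preEquivalence F f).functor).2 (h _)

end IsFundamentalLocalizer

/-! ### Strict fiber products and cartesian squares in `Cat`. -/

/-- The strict fiber product of two functors. -/
structure StrictPullback {A B C : Type u} [SmallCategory A] [SmallCategory B] [SmallCategory C]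
    (F : A ⥤ C) (G : B ⥤ C) : Type u where
  left : A
  right : B
  eq : F.obj left = G.obj right

namespace StrictPullback

variable {A B C D : Type u} [SmallCategory A] [SmallCategory B] [SmallCategory C]
  [SmallCategory D] {F : A ⥤ C} {G : B ⥤ C}

/-- Morphisms of the strict fiber product. -/
@[ext]
structure Hom (X Y : StrictPullback F G) : Type u where
  left : X.left ⟶ Y.left
  right : X.right ⟶ Y.right
  w : F.map left ≫ eqToHom Y.eq = eqToHom X.eq ≫ G.map right

instance : SmallCategory (StrictPullback F G) where
  Hom := Hom
  id X := ⟨𝟙 _, 𝟙 _, by simp⟩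
  comp f g := ⟨f.left ≫ g.left, f.right ≫ g.right, by
    rw [F.map_comp, Category.assoc, g.w, reassoc_of% f.w, G.map_comp]⟩
  id_comp f := by apply Hom.ext <;> simp
  comp_id f := by apply Hom.ext <;> simp
  assoc f g h := by apply Hom.ext <;> simp

@[ext]
lemma hom_ext {X Y : StrictPullback F G} {f g : X ⟶ Y} (h₁ : f.left = g.left)
    (h₂ : f.right = g.right) : f = g :=
  Hom.ext h₁ h₂

variable (F G) in
/-- The first projection. -/
@[simps]
def fst : StrictPullback F G ⥤ A where
  obj X := X.left
  map f := f.left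

variable (F G) in
/-- The second projection. -/
@[simps]
def snd : StrictPullback F G ⥤ B where
  obj X := X.right
  map f := f.right

lemma condition : fst F G ⋙ F = snd F G ⋙ G :=
  CategoryTheory.Functor.ext (fun X => X.eq) (fun X Y f => by
    change F.map f.left = eqToHom X.eq ≫ G.map f.right ≫ eqToHom Y.eq.symm
    have h := f.w
    rw [← reassoc_of% h]
    simp)

/-- The functor to the strict fiber product given by a commutative square. -/
def lift {H : D ⥤ A} {K : D ⥤ B} (h : H ⋙ F = K ⋙ G) : D ⥤ StrictPullback F G where
  obj x := ⟨H.obj x, K.obj x, Functor.congr_obj h x⟩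
  map f := ⟨H.map f, K.map f, by
    have := Functor.congr_hom h f
    dsimp at this
    simp [this]⟩
  map_id x := by apply Hom.ext <;> simp <;> rfl
  map_comp f g := by apply Hom.ext <;> simp <;> rfl

lemma eqToHom_left {X Y : StrictPullback F G} (h : X = Y) :
    (eqToHom h).left = eqToHom (congrArg left h) := by
  subst h; rfl

lemma eqToHom_right {X Y : StrictPullback F G} (h : X = Y) :
    (eqToHom h).right = eqToHom (congrArg right h) := by
  subst h; rfl

lemma functor_ext {H K : D ⥤ StrictPullback F G} (h₁ : H ⋙ fst F G = K ⋙ fst F G)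
    (h₂ : H ⋙ snd F G = K ⋙ snd F G) : H = K := by
  have hobj (x : D) : H.obj x = K.obj x := by
    have e₁ : (H.obj x).left = (K.obj x).left := Functor.congr_obj h₁ x
    have e₂ : (H.obj x).right = (K.obj x).right := Functor.congr_obj h₂ x
    cases hx : H.obj x
    cases hy : K.obj x
    simp_all
  refine CategoryTheory.Functor.ext hobj fun x y f => ?_
  apply Hom.ext
  · change _ = (eqToHom (hobj x)).left ≫ (K.map f).left ≫ (eqToHom (hobj y).symm).left
    rw [eqToHom_left, eqToHom_left]
    exact Functor.congr_hom h₁ f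
  · change _ = (eqToHom (hobj x)).right ≫ (K.map f).right ≫ (eqToHom (hobj y).symm).right
    rw [eqToHom_right, eqToHom_right]
    exact Functor.congr_hom h₂ f

lemma isPullback {A B C : Cat.{u, u}} (F : A ⟶ C) (G : B ⟶ C) :
    IsPullback (fst F.toFunctor G.toFunctor).toCatHom (snd F.toFunctor G.toFunctor).toCatHom F G := by
  let l (s : PullbackCone F G) : s.pt ⥤ StrictPullback F.toFunctor G.toFunctor :=
    lift (H := s.fst.toFunctor) (K := s.snd.toFunctor) (congrArg Cat.Hom.toFunctor s.condition)
  exact ⟨⟨Cat.Hom.ext condition⟩, ⟨PullbackCone.IsLimit.mk _ (fun s => (l s).toCatHom)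
    (fun _ => rfl) (fun _ => rfl) (fun s m h₁ h₂ => Cat.Hom.ext (functor_ext
      (congrArg Cat.Hom.toFunctor h₁) (congrArg Cat.Hom.toFunctor h₂)))⟩⟩

end StrictPullback

/-- An elementwise form of the universal property of a pullback square of categories. -/
structure IsStrictPullback {A' A B' B : Type u} [SmallCategory A'] [SmallCategory A]
    [SmallCategory B'] [SmallCategory B] (v : A' ⥤ A) (u' : A' ⥤ B') (u : A ⥤ B) (w : B' ⥤ B) :
    Prop where
  comm : v ⋙ u = u' ⋙ w
  exists_obj : ∀ (a : A) (b : B'), u.obj a = w.obj b → ∃ x, v.obj x = a ∧ u'.obj x = b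
  exists_hom : ∀ {x y : A'} (α : v.obj x ⟶ v.obj y) (β : u'.obj x ⟶ u'.obj y),
    u.map α ≫ eqToHom (Functor.congr_obj comm y) =
      eqToHom (Functor.congr_obj comm x) ≫ w.map β → ∃ γ : x ⟶ y, v.map γ = α ∧ u'.map γ = β
  hom_ext : ∀ {x y : A'} (γ γ' : x ⟶ y), v.map γ = v.map γ' → u'.map γ = u'.map γ' → γ = γ'

/-- The comparison with the concrete fiber product is an isomorphism, so objects lift on the nose
and arrows lift uniquely. -/
lemma CategoryTheory.IsPullback.isStrictPullback {A' A B' B : Cat.{u, u}} {v : A' ⟶ A}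
    {u' : A' ⟶ B'} {u : A ⟶ B} {w : B' ⟶ B} (h : IsPullback v u' u w) :
    IsStrictPullback v.toFunctor u'.toFunctor u.toFunctor w.toFunctor := by
  have hcomm : v.toFunctor ⋙ u.toFunctor = u'.toFunctor ⋙ w.toFunctor :=
    congrArg Cat.Hom.toFunctor h.w
  let Φ := StrictPullback.lift hcomm
  let e := h.isoIsPullback _ _ (StrictPullback.isPullback u w)
  have he : e.hom.toFunctor = Φ := StrictPullback.functor_ext
    (congrArg Cat.Hom.toFunctor (h.isoIsPullback_hom_fst _ _ (StrictPullback.isPullback u w)))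
    (congrArg Cat.Hom.toFunctor (h.isoIsPullback_hom_snd _ _ (StrictPullback.isPullback u w)))
  have : Φ.IsEquivalence := he ▸ (Cat.equivOfIso e).isEquivalence_functor
  refine ⟨hcomm, fun a b hab => ⟨e.inv.toFunctor.obj ⟨a, b, hab⟩, ?_, ?_⟩, fun {x y} α β hαβ => ?_,
    fun γ γ' h₁ h₂ => Φ.map_injective (StrictPullback.hom_ext h₁ h₂)⟩
  · exact Functor.congr_obj (congrArg Cat.Hom.toFunctor
      (h.isoIsPullback_inv_fst _ _ (StrictPullback.isPullback u w))) _
  · exact Functor.congr_obj (congrArg Cat.Hom.toFunctor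
      (h.isoIsPullback_inv_snd _ _ (StrictPullback.isPullback u w))) _
  · obtain ⟨γ, hγ⟩ := Φ.map_surjective (X := x) (Y := y) ⟨α, β, hαβ⟩
    exact ⟨γ, congrArg StrictPullback.Hom.left hγ, congrArg StrictPullback.Hom.right hγ⟩

/-! ### Fibers, slices and their coslices under base change. -/

namespace IsStrictPullback

variable {A' A B' B : Type u} [SmallCategory A'] [SmallCategory A]
    [SmallCategory B'] [SmallCategory B] {v : A' ⥤ A} {u' : A' ⥤ B'} {u : A ⥤ B} {w : B' ⥤ B}
    (h : IsStrictPullback v u' u w)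
include h

/-- A strictly commutative square, with the identity 2-cell. -/
abbrev twoSquare : TwoSquare v u' u w := TwoSquare.mk _ _ _ _ (eqToHom h.comm)

/-- The functor between fibers. -/
def fiberMap (b : B') : u'.Fiber b ⥤ u.Fiber (w.obj b) :=
  Functor.Fiber.inducedFunctor (F := Functor.Fiber.fiberInclusion ⋙ v) (by
    rw [Functor.assoc, h.comm, ← Functor.assoc, Functor.Fiber.fiberInclusion_comp_eq_const,
      Functor.ext_of_iso (Functor.constComp _ b w) (fun _ => rfl)])

instance isEquivalence_fiberMap (b : B') : (h.fiberMap b).IsEquivalence where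
  faithful := ⟨fun {x y} φ ψ hφψ => by
    ext
    refine h.hom_ext _ _ (congrArg Functor.Fiber.fiberInclusion.map hφψ) ?_
    rw [IsHomLift.fac' u' (𝟙 b), IsHomLift.fac' u' (𝟙 b) (Functor.Fiber.fiberInclusion.map ψ)]⟩
  full := ⟨fun {x y} φ => by
    -- Over `B'` the lift must be the identity of `b`, here an `eqToHom` between the images of `x`
    -- and `y`.
    obtain ⟨γ, hγ, hγ'⟩ := h.exists_hom (x := x.1) (y := y.1) φ.1
      (eqToHom (x.2.trans y.2.symm)) (by
        have := φ.2
        have hφ := IsHomLift.fac' u (𝟙 (w.obj b)) φ.1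
        simp only [Category.id_comp] at hφ
        refine (congrArg (· ≫ _) hφ).trans ?_
        rw [eqToHom_map]
        exact (congrArg (· ≫ _) (eqToHom_trans _ _)).trans
          ((eqToHom_trans _ _).trans (eqToHom_trans _ _).symm))
    refine ⟨⟨γ, IsHomLift.of_fac' _ _ _ x.2 y.2 (by simp [hγ'])⟩, ?_⟩
    exact Subtype.ext hγ⟩
  essSurj := ⟨fun y => by
    obtain ⟨x, hx, hx'⟩ := h.exists_obj y.1 b y.2
    exact ⟨⟨x, hx'⟩, ⟨eqToIso (Subtype.ext hx)⟩⟩⟩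

/-- The inclusions of fibers into slices are compatible with the functors induced by the square. -/
def fiberToSliceIso (b : B') :
    fiberToSlice u' b ⋙ h.twoSquare.costructuredArrowRightwards b ≅
      h.fiberMap b ⋙ fiberToSlice u (w.obj b) :=
  NatIso.ofComponents (fun x => CostructuredArrow.isoMk (Iso.refl _) (by
      change u.map (𝟙 (v.obj x.1)) ≫ eqToHom ((h.fiberMap b).obj x).2 =
        (eqToHom h.comm : v ⋙ u ⟶ u' ⋙ w).app x.1 ≫ w.map (eqToHom x.2)
      simp [eqToHom_map, eqToHom_app]))
    (fun f => by
      ext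
      exact (Category.comp_id _).trans (Category.id_comp _).symm)

end IsStrictPullback

namespace IsStrictPullback

variable {A' A B' B : Type u} [SmallCategory A'] [SmallCategory A]
    [SmallCategory B'] [SmallCategory B] {v : A' ⥤ A} {u' : A' ⥤ B'} {u : A ⥤ B} {w : B' ⥤ B}
    (h : IsStrictPullback v u' u w) {b : B'}
include h

lemma exists_hom_over {x y : A'} (hy : u'.obj y = b) (θ : v.obj x ⟶ v.obj y) (g : u'.obj x ⟶ b)
    (hθ : u.map θ ≫ eqToHom ((Functor.congr_obj h.comm y).trans (congrArg w.obj hy)) =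
      eqToHom (Functor.congr_obj h.comm x) ≫ w.map g) :
    ∃ γ : x ⟶ y, v.map γ = θ ∧ u'.map γ ≫ eqToHom hy = g := by
  subst hy
  simpa using h.exists_hom θ g hθ

lemma hom_over_ext {x y : A'} (hy : u'.obj y = b) {γ γ' : x ⟶ y} (hγ : v.map γ = v.map γ')
    (hγ' : u'.map γ ≫ eqToHom hy = u'.map γ' ≫ eqToHom hy) : γ = γ' :=
  h.hom_ext _ _ hγ ((cancel_mono _).1 hγ')

lemma hom_fiberToSlice_ext {p : CostructuredArrow u' b} {x : u'.Fiber b}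
    {γ γ' : p ⟶ (fiberToSlice u' b).obj x} (hγ : v.map γ.left = v.map γ'.left) : γ = γ' := by
  ext
  exact h.hom_over_ext x.2 hγ ((CostructuredArrow.w γ).trans (CostructuredArrow.w γ').symm)

lemma exists_hom_fiberToSlice {p : CostructuredArrow u' b} {x : u'.Fiber b}
    (θ : (h.twoSquare.costructuredArrowRightwards b).obj p ⟶
      (fiberToSlice u (w.obj b)).obj ((h.fiberMap b).obj x)) :
    ∃ γ : p ⟶ (fiberToSlice u' b).obj x, v.map γ.left = θ.left := by
  have hθ : u.map θ.left ≫ eqToHom ((h.fiberMap b).obj x).2 =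
      (eqToHom h.comm : v ⋙ u ⟶ u' ⋙ w).app p.left ≫ w.map p.hom := CostructuredArrow.w θ
  rw [eqToHom_app] at hθ
  obtain ⟨γ, hγ, hγ'⟩ := h.exists_hom_over (x := p.left) x.2 θ.left p.hom hθ
  exact ⟨CostructuredArrow.homMk γ hγ', hγ⟩

/-- The functor induced by a pullback square on coslices of inclusions of fibers into slices. -/
abbrev coslicesMap (p : CostructuredArrow u' b) :
    StructuredArrow p (fiberToSlice u' b) ⥤
      StructuredArrow ((h.twoSquare.costructuredArrowRightwards b).obj p)
        (fiberToSlice u (w.obj b)) :=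
  StructuredArrow.map₂ (F := h.fiberMap b) (G := h.twoSquare.costructuredArrowRightwards b)
    (𝟙 _) (h.fiberToSliceIso b).hom

lemma coslicesMap_obj_hom_left (p : CostructuredArrow u' b)
    (x : StructuredArrow p (fiberToSlice u' b)) :
    ((h.coslicesMap p).obj x).hom.left = v.map x.hom.left := by
  change 𝟙 _ ≫ v.map x.hom.left ≫ 𝟙 _ = _
  exact (Category.id_comp _).trans (Category.comp_id _)

/-- An arrow from `p` to a fiber object has base component `p.hom`, so it amounts to its image in
`A`; the fibers themselves correspond by `fiberMap`. -/
instance isEquivalence_coslicesMap (p : CostructuredArrow u' b) :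
    (h.coslicesMap p).IsEquivalence where
  full := ⟨fun {x y} φ => by
    obtain ⟨ψ, hψ⟩ := (h.fiberMap b).map_surjective (X := x.right) (Y := y.right) φ.right
    refine ⟨StructuredArrow.homMk ψ (h.hom_fiberToSlice_ext ?_), ?_⟩
    · have e := congrArg CommaMorphism.left (StructuredArrow.w φ)
      have e' : ((h.coslicesMap p).obj x).hom.left ≫ φ.right.1 =
        ((h.coslicesMap p).obj y).hom.left := e
      rw [coslicesMap_obj_hom_left, coslicesMap_obj_hom_left, ← hψ] at e'
      exact (v.map_comp _ _).trans e'
    · ext : 1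
      exact hψ⟩
  essSurj := ⟨fun y => by
    let x := (h.fiberMap b).objPreimage y.right
    let i : (h.fiberMap b).obj x ≅ y.right := (h.fiberMap b).objObjPreimageIso y.right
    obtain ⟨γ, hγ⟩ := h.exists_hom_fiberToSlice (x := x)
      (y.hom ≫ (fiberToSlice u (w.obj b)).map i.inv)
    refine ⟨StructuredArrow.mk γ, ⟨StructuredArrow.isoMk i ?_⟩⟩
    have hi : y.hom ≫ (fiberToSlice u (w.obj b)).map i.inv =
        ((h.coslicesMap p).obj (StructuredArrow.mk γ)).hom := by
      ext
      exact ((h.coslicesMap_obj_hom_left p (StructuredArrow.mk γ)).trans hγ).symm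
    rw [← hi, Category.assoc]
    exact (congrArg (y.hom ≫ ·) ((fiberToSlice u (w.obj b)).mapIso i).inv_hom_id).trans
      (Category.comp_id _)⟩

end IsStrictPullback

/-! ### Properness against weak exactness. -/

namespace IsFundamentalLocalizer

variable {W : MorphismProperty Cat.{u, u}} (hW : IsFundamentalLocalizer W)
variable {A' A B' B : Type u} [SmallCategory A'] [SmallCategory A]
    [SmallCategory B'] [SmallCategory B] {v : A' ⥤ A} {u' : A' ⥤ B'} {u : A ⥤ B} {w : B' ⥤ B}
    (h : IsStrictPullback v u' u w)

include hW

lemma isWProper_iff : IsWProper W u ↔ ∀ (b : B) (p : CostructuredArrow u b),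
    IsWAspherical W (StructuredArrow p (fiberToSlice u b)) :=
  forall_congr' fun _ => hW.isWCoaspherical_iff _

include h

/-- Asphericity of the coslices of the inclusions of fibers into slices may be tested after a
base change. -/
lemma isWAspherical_coslice_iff {b : B'} (p : CostructuredArrow u' b) :
    IsWAspherical W (StructuredArrow p (fiberToSlice u' b)) ↔
      IsWAspherical W (StructuredArrow ((h.twoSquare.costructuredArrowRightwards b).obj p)
        (fiberToSlice u (w.obj b))) :=
  hW.isWAspherical_iff_of_isLeftAdjoint (h.coslicesMap p)

/-- Proper functors are stable under base change. -/
lemma isWProper_of_isStrictPullback (hu : IsWProper W u) : IsWProper W u' :=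
  hW.isWProper_iff.2 fun _ p =>
    (hW.isWAspherical_coslice_iff h p).2 (hW.isWProper_iff.1 hu _ _)

/-- A pullback square of a proper functor is weakly exact. -/
lemma isWeaklyWExact_of_isWProper (hu : IsWProper W u) : IsWeaklyWExact W h.twoSquare :=
  fun b => by
  have hu' := hW.isWProper_iff.1 (hW.isWProper_of_isStrictPullback h hu) b
  -- Up to isomorphism this composite is the equivalence of fibers followed by `fiberToSlice u
  -- (w.obj b)`, which is coaspherical.
  have hcomp (y : CostructuredArrow u (w.obj b)) : IsWAspherical W
      (StructuredArrow y (fiberToSlice u' b ⋙ h.twoSquare.costructuredArrowRightwards b)) := by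
    rw [hW.isWAspherical_iff_of_isLeftAdjoint
      (StructuredArrow.mapNatIso (h.fiberToSliceIso b)).functor,
      hW.isWAspherical_iff_of_isLeftAdjoint
        (StructuredArrow.pre y (h.fiberMap b) (fiberToSlice u (w.obj b)))]
    exact hW.isWProper_iff.1 hu _ _
  intro a
  exact hW.of_comp_left
    (hW.isColocalWEquivalence_of_coslices (fiberToSlice u' b) hu'
      (h.twoSquare.costructuredArrowRightwards b ⋙ CostructuredArrow.proj u (w.obj b)) a)
    (hW.isColocalWEquivalence_of_coslices _ hcomp (CostructuredArrow.proj u (w.obj b)) a)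

/-- Given a weakly exact base change of `u` to an object `w.obj b` such that the slice of `u` over it
is all of `A`, the inclusion of the fiber into this slice has aspherical coslices. -/
lemma isWAspherical_coslice_of_isWeaklyWExact (b : B')
    (hfull : (CostructuredArrow.proj u (w.obj b)).Full) (hfib : (fiberToSlice u' b).IsEquivalence)
    (hex : IsWeaklyWExact W h.twoSquare) (p : CostructuredArrow u (w.obj b)) :
    IsWAspherical W (StructuredArrow p (fiberToSlice u (w.obj b))) := by
  let P := CostructuredArrow.proj u (w.obj b)
  -- `P` is fully faithful, so `p` with its identity is initial among arrows from `P.obj p` to the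
  -- slice.
  have h₀ : IsWAspherical W (StructuredArrow (P.obj p) P) :=
    hW.isWAspherical_of_isInitial (StructuredArrow.mkIdInitial (T := P) (Y := p))
  have h₁ := (hW.isWAspherical_iff (hex b (P.obj p))).2 h₀
  -- The slice of `u'` is traded for its fiber, then for the fiber of `u`; full faithfulness finally
  -- removes `P`.
  have h₂ := (hW.isWAspherical_iff_of_isLeftAdjoint (StructuredArrow.pre (P.obj p)
    (fiberToSlice u' b) (h.twoSquare.costructuredArrowRightwards b ⋙ P))).2 h₁
  have h₃ := (hW.isWAspherical_iff_of_isLeftAdjoint (StructuredArrow.mapNatIso (S := P.obj p)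
    (Functor.isoWhiskerRight (h.fiberToSliceIso b) P)).functor).1 h₂
  have h₄ := (hW.isWAspherical_iff_of_isLeftAdjoint (StructuredArrow.pre (P.obj p) (h.fiberMap b)
    (fiberToSlice u (w.obj b) ⋙ P))).1 h₃
  exact (hW.isWAspherical_iff_of_isLeftAdjoint
    (StructuredArrow.post p (fiberToSlice u (w.obj b)) P)).2 h₄

end IsFundamentalLocalizer

/-! ### Reduction to base changes along `B/b` and its terminal object. -/

/-- For a functor to the point, the fiber is equivalent to the slice. -/
lemma isEquivalence_fiberToSlice_punit {A : Type u} [SmallCategory A]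
    (F : A ⥤ Discrete PUnit.{u + 1}) (b : Discrete PUnit.{u + 1}) :
    (fiberToSlice F b).IsEquivalence where
  faithful := ⟨fun hφ => Functor.Fiber.hom_ext (congrArg CommaMorphism.left hφ)⟩
  full := ⟨fun {x y} φ =>
    ⟨⟨φ.left, IsHomLift.of_fac' _ _ _ x.2 y.2 (Subsingleton.elim _ _)⟩, by ext; rfl⟩⟩
  essSurj := ⟨fun y => ⟨⟨y.left, Subsingleton.elim _ _⟩,
    ⟨CostructuredArrow.isoMk (Iso.refl _) (Subsingleton.elim _ _)⟩⟩⟩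

lemma StrictPullback.isStrictPullback {A B C : Type u} [SmallCategory A] [SmallCategory B]
    [SmallCategory C] (F : A ⥤ C) (G : B ⥤ C) :
    IsStrictPullback (StrictPullback.fst F G) (StrictPullback.snd F G) F G where
  comm := StrictPullback.condition
  exists_obj a b hab := ⟨⟨a, b, hab⟩, rfl, rfl⟩
  exists_hom α β hαβ := ⟨⟨α, β, hαβ⟩, rfl, rfl⟩
  hom_ext _ _ h₁ h₂ := StrictPullback.hom_ext h₁ h₂

/-- A functor is proper if the base changes of its pullbacks to slices, along the inclusions of the
terminal objects, are weakly exact. -/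
lemma IsFundamentalLocalizer.isWProper_of_isWeaklyWExact {W : MorphismProperty Cat.{u, u}}
    (hW : IsFundamentalLocalizer W) {A B : Type u} [SmallCategory A] [SmallCategory B] (F : A ⥤ B)
    (hF : ∀ b : B, IsWeaklyWExact W (StrictPullback.isStrictPullback
      (StrictPullback.snd F (Over.forget b))
      (Functor.fromPUnit.{u} (Over.mk (𝟙 b)))).twoSquare) : IsWProper W F := by
  refine hW.isWProper_iff.2 fun b p => ?_
  let h := StrictPullback.isStrictPullback F (Over.forget b)
  let x : StrictPullback F (Over.forget b) := ⟨p.left, Over.mk p.hom, rfl⟩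
  -- `q` is `p` seen over `B/b`: its structure arrow is the unique map to the terminal object.
  let q : CostructuredArrow (StrictPullback.snd F (Over.forget b)) (Over.mk (𝟙 b)) :=
    CostructuredArrow.mk (Y := x) (Over.homMk (U := Over.mk p.hom) (V := Over.mk (𝟙 b)) p.hom)
  have hq := hW.isWAspherical_coslice_of_isWeaklyWExact
    (StrictPullback.isStrictPullback (StrictPullback.snd F (Over.forget b))
      (Functor.fromPUnit.{u} (Over.mk (𝟙 b)))) ⟨⟨⟩⟩
    -- Over a terminal object, compatibility with structure arrows is automatic.
    ⟨fun φ => ⟨CostructuredArrow.homMk φ (Over.mkIdTerminal.hom_ext _ _), rfl⟩⟩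
    (isEquivalence_fiberToSlice_punit _ _) (hF b) q
  let p' : CostructuredArrow F ((Over.forget b).obj (Over.mk (𝟙 b))) := p
  let e : p' ≅ (h.twoSquare.costructuredArrowRightwards (Over.mk (𝟙 b))).obj q :=
    CostructuredArrow.isoMk (Iso.refl _) (by
      change F.map (𝟙 p.left) ≫ (eqToHom h.comm : StrictPullback.fst _ _ ⋙ F ⟶ _).app q.left ≫
        p.hom = p.hom
      rw [eqToHom_app, F.map_id]
      exact (Category.id_comp _).trans (Category.id_comp _))
  exact (hW.isWAspherical_iff_of_isLeftAdjoint
    (StructuredArrow.mapIso (T := fiberToSlice F _) e).functor).2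
    ((hW.isWAspherical_coslice_iff h q).1 hq)

theorem mainTheorem8 (W : MorphismProperty Cat.{u, u}) (hW : IsFundamentalLocalizer W)
    {A B : Cat.{u, u}} (f : A ⟶ B) :
    IsWProper W f.toFunctor ↔
      ∀ (A' B' A'' B'' : Cat.{u, u}) (v : A' ⟶ A) (f' : A' ⟶ B') (w : B' ⟶ B)
        (v' : A'' ⟶ A') (f'' : A'' ⟶ B'') (w' : B'' ⟶ B')
        (_right : IsPullback v f' f w) (left : IsPullback v' f'' f' w'),
        IsWeaklyWExact W (identitySquare left.w) := by
  refine ⟨fun hf A' B' A'' B'' v f' w v' f'' w' right left =>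
    hW.isWeaklyWExact_of_isWProper left.isStrictPullback
      (hW.isWProper_of_isStrictPullback right.isStrictPullback hf), fun H => ?_⟩
  refine hW.isWProper_of_isWeaklyWExact f.toFunctor fun b => ?_
  let w : Cat.of (Over b) ⟶ B := (Over.forget b).toCatHom
  let w' : Cat.of (Discrete PUnit.{u + 1}) ⟶ Cat.of (Over b) :=
    (Functor.fromPUnit (Over.mk (𝟙 b))).toCatHom
  let f' : Cat.of (StrictPullback f.toFunctor w.toFunctor) ⟶ Cat.of (Over b) :=
    (StrictPullback.snd f.toFunctor w.toFunctor).toCatHom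
  exact H _ _ _ _ _ f' w _ _ w' (StrictPullback.isPullback f w) (StrictPullback.isPullback f' w')
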